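/- Let $\alpha>0$, $z_0\in\mathbb R$, and let $f:[0,\infty)\to(0,\infty)$ be a classical solution of the initial value problem $$\frac{f''(x)}{1+f'(x)^2}+\frac{f'(x)}{x}=\frac{\alpha}{f(x)}\quad(x>0),\qquad f(0)=z_0,\quad f'(0)=0,$$ that is, $f$ is twice differentiable on $(0,\infty)$, satisfies the equation there, and has one-sided derivative $0$ at $x=0$. Then for all $r>0$ and all $0\le x<r$, $$f(x)<\left(\frac{\alpha+2}{\alpha}\right)f(r)-\sqrt{r^2+\frac{4f(r)^2}{\alpha^2}-x^2}.$$ As a consequence, the lowest point of $f$, which is $f(0)$ (that is, $f(0)<f(x)$ for all $x>0$), satisfies $$f(0)<\left(\frac{\alpha+2}{\alpha}\right)f(r)-\sqrt{r^2+\frac{4f(r)^2}{\alpha^2}}\qquad\text{for all } r>0.$$ -/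

import Mathlib

/-- `f : [0, ∞) → (0, ∞)` is a (classical) solution of the singular initial value problem
`f'' / (1 + f' ^ 2) + f' / x = α / f` for `x > 0`, with `f 0 = z₀` and `f' 0 = 0`.
Only the values of `f` on `[0, ∞)` matter; the derivative at `0` is one-sided. -/
structure IsRotationalSolution (α z₀ : ℝ) (f : ℝ → ℝ) : Prop where
  pos : ∀ x : ℝ, 0 ≤ x → 0 < f x
  differentiableAt : ∀ x : ℝ, 0 < x → DifferentiableAt ℝ f x
  differentiableAt_deriv : ∀ x : ℝ, 0 < x → DifferentiableAt ℝ (deriv f) x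
  ode : ∀ x : ℝ, 0 < x →
    deriv (deriv f) x / (1 + deriv f x ^ 2) + deriv f x / x = α / f x
  init : f 0 = z₀
  init_deriv : HasDerivWithinAt f 0 (Set.Ici 0) 0

/-! The inequality is a comparison of the graph of `f` with the lower arc
`g x = (α + 2) / α * f r - √(R ^ 2 - x ^ 2)`, `R ^ 2 = r ^ 2 + 4 * f r ^ 2 / α ^ 2`,
which meets the graph at `x = r`. Write `θ = arctan f'`, so that the equation becomes
`θ' + tan θ / x = α / f`. The arc satisfies `φ' + tan φ / x = 2 / √(R ^ 2 - x ^ 2)` with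
`φ = arcsin (x / R)`, and `R` is chosen so that `2 / √(R ^ 2 - r ^ 2) = α / f r`.

If `f` increases, then on `(0, r)` the right-hand side for `f` exceeds `α / f r`, which exceeds the
right-hand side for the arc. So `θ - φ` has positive derivative wherever it is nonpositive; by
`exists_le_neg_of_deriv_pos_of_nonpos`, were it nonpositive somewhere it would be bounded away
from `0` by a negative constant near `0`, whereas `θ > 0` and `φ → 0`. Hence `f' > g'` on `(0, r)`
(`IsRotationalSolution.arc_slope_lt_deriv`), and `f r = g r` gives `f < g` on `[0, r)`.

The same principle gives `f' > 0` (`IsRotationalSolution.deriv_pos`): the equation forces `f'' > 0`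
where `f' ≤ 0`, so a nonpositive value of `f'` would bound `f'` by a negative constant near `0`,
against the one-sided derivative `0` at `0`. Continuity of `f'` at `0` is never needed. -/

open Set Filter Topology

/-- A function whose derivative is positive wherever its value is nonpositive lies, to the left of
a nonpositive value, below that value. -/
lemma lt_of_deriv_pos_of_nonpos {D D' : ℝ → ℝ} {y b : ℝ}
    (hD : ∀ x ∈ Icc y b, HasDerivAt D (D' x) x)
    (hpos : ∀ x ∈ Icc y b, D x ≤ 0 → 0 < D' x) (hyb : y < b) (hb : D b ≤ 0) : D y < D b := by
  -- A minimum point on `[y, b]` has a nonpositive value, so it can only be the left endpoint.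
  have key : ∀ m ∈ Icc y b, y < m → D m ≤ 0 → ∃ z ∈ Icc y b, D z < D m := by
    intro m hm hym hm0
    have h1 : ∀ᶠ z in 𝓝[<] m, 0 < slope D m z :=
      (((hasDerivAt_iff_tendsto_slope.1 (hD m hm)).mono_left
        (nhdsWithin_mono _ fun z hz => ne_of_lt hz)).eventually
          (lt_mem_nhds (hpos m hm hm0)))
    obtain ⟨z, hz, hzy, hzm⟩ := (h1.and (Ioo_mem_nhdsLT hym)).exists
    refine ⟨z, ⟨hzy.le, hzm.le.trans hm.2⟩, ?_⟩
    rw [slope_def_field, div_pos_iff] at hz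
    rcases hz with hz | hz <;> linarith [hz.1, hz.2]
  obtain ⟨m, hm, hmin⟩ := isCompact_Icc.exists_isMinOn (nonempty_Icc.2 hyb.le)
    (fun x hx => (hD x hx).continuousAt.continuousWithinAt : ContinuousOn D (Icc y b))
  have hmb : D m ≤ D b := hmin (right_mem_Icc.2 hyb.le)
  have hmy : m = y := by
    by_contra hne
    obtain ⟨z, hz, hlt⟩ := key m hm (lt_of_le_of_ne hm.1 (Ne.symm hne)) (hmb.trans hb)
    exact absurd (hmin hz) (not_le.2 hlt)
  obtain ⟨z, hz, hlt⟩ := key b (right_mem_Icc.2 hyb.le) hyb hb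
  exact hmy ▸ (hmin hz : D m ≤ D z).trans_lt hlt

/-- A function on `(0, b)` whose derivative is positive wherever its value is nonpositive is either
positive, or bounded above by a negative constant near `0`. -/
lemma exists_le_neg_of_deriv_pos_of_nonpos {D D' : ℝ → ℝ} {b x₁ : ℝ}
    (hD : ∀ x ∈ Ioo 0 b, HasDerivAt D (D' x) x)
    (hpos : ∀ x ∈ Ioo 0 b, D x ≤ 0 → 0 < D' x) (hx₁ : x₁ ∈ Ioo 0 b) (h : D x₁ ≤ 0) :
    ∃ c < 0, ∃ x₀ ∈ Ioo 0 b, ∀ x ∈ Ioo 0 x₀, D x < c := by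
  have step : ∀ z ∈ Ioo 0 b, D z ≤ 0 → ∀ y ∈ Ioo 0 z, D y < D z := by
    intro z hz hz0 y hy
    have hsub : ∀ x ∈ Icc y z, x ∈ Ioo 0 b := fun x hx =>
      ⟨hy.1.trans_le hx.1, hx.2.trans_lt hz.2⟩
    exact lt_of_deriv_pos_of_nonpos (fun x hx => hD x (hsub x hx))
      (fun x hx => hpos x (hsub x hx)) hy.2 hz0
  have hx₀ : x₁ / 2 ∈ Ioo 0 x₁ := ⟨half_pos hx₁.1, half_lt_self hx₁.1⟩
  have hx₀b : x₁ / 2 ∈ Ioo 0 b := ⟨hx₀.1, hx₀.2.trans hx₁.2⟩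
  have hc : D (x₁ / 2) < 0 := (step x₁ hx₁ h _ hx₀).trans_le h
  exact ⟨_, hc, _, hx₀b, step _ hx₀b hc.le⟩

namespace IsRotationalSolution

variable {α z₀ : ℝ} {f : ℝ → ℝ}

lemma continuousOn (hf : IsRotationalSolution α z₀ f) : ContinuousOn f (Ici 0) := by
  intro x hx
  rcases eq_or_lt_of_le (mem_Ici.1 hx) with rfl | hx
  · exact hf.init_deriv.continuousWithinAt
  · exact (hf.differentiableAt x hx).continuousAt.continuousWithinAt

lemma deriv_pos (hα : 0 < α) (hf : IsRotationalSolution α z₀ f) {x : ℝ} (hx : 0 < x) :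
    0 < deriv f x := by
  by_contra! hneg
  obtain ⟨c, hc, x₀, hx₀, hlt⟩ := exists_le_neg_of_deriv_pos_of_nonpos (b := x + 1)
    (fun y hy => (hf.differentiableAt_deriv y hy.1).hasDerivAt)
    (fun y hy hy0 => by
      have h1 := hf.ode y hy.1
      have h2 : 0 < α / f y := div_pos hα (hf.pos y hy.1.le)
      have h3 : deriv f y / y ≤ 0 := div_nonpos_of_nonpos_of_nonneg hy0 hy.1.le
      have h4 : 0 < deriv (deriv f) y / (1 + deriv f y ^ 2) := by linarith
      exact (div_pos_iff_of_pos_right (by positivity)).1 h4)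
    ⟨hx, lt_add_one x⟩ hneg
  -- The difference quotients at `0` are values of `f'`, hence bounded by `c < 0`.
  have h1 : ∀ᶠ y in 𝓝[>] (0 : ℝ), c < slope f 0 y :=
    ((hasDerivWithinAt_iff_tendsto_slope.1 hf.init_deriv).mono_left
      (nhdsWithin_mono _ fun z hz => ⟨le_of_lt hz, ne_of_gt hz⟩)).eventually (lt_mem_nhds hc)
  obtain ⟨y, hy, hy0, hyx⟩ := (h1.and (Ioo_mem_nhdsGT hx₀.1)).exists
  obtain ⟨ξ, hξ, hslope⟩ := exists_deriv_eq_slope f hy0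
    (hf.continuousOn.mono fun z hz => hz.1)
    (fun z hz => (hf.differentiableAt z hz.1).differentiableWithinAt)
  have h2 := hlt ξ ⟨hξ.1, hξ.2.trans hyx⟩
  rw [hslope, ← slope_def_field] at h2
  exact lt_asymm hy h2

lemma strictMonoOn (hα : 0 < α) (hf : IsRotationalSolution α z₀ f) :
    StrictMonoOn f (Ici 0) :=
  strictMonoOn_of_deriv_pos (convex_Ici 0) hf.continuousOn fun x hx =>
    hf.deriv_pos hα (by simpa using hx)

/-- The comparison of slopes: on `(0, r)` the graph of `f` is steeper than any circular arc centred
on the axis whose curvature sum at `r`, `2 / √(R ^ 2 - r ^ 2)`, is `α / f r`. -/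
lemma arc_slope_lt_deriv (hα : 0 < α) (hf : IsRotationalSolution α z₀ f) {r R x : ℝ}
    (hR : 0 < R) (hrR : r < R) (hcurv : 2 / √(R ^ 2 - r ^ 2) = α / f r) (hx : x ∈ Ioo 0 r) :
    x / √(R ^ 2 - x ^ 2) < deriv f x := by
  have hs : ∀ y ∈ Ioo 0 r, 0 < R ^ 2 - y ^ 2 := fun y hy => by
    nlinarith [hy.1, hy.2]
  -- The inclination of the arc, `arcsin (y / R)`, written through its tangent.
  have harc : ∀ y ∈ Ioo 0 r, HasDerivAt (fun t => Real.arctan (t / √(R ^ 2 - t ^ 2)))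
      (1 / √(R ^ 2 - y ^ 2)) y := by
    intro y hy
    have hp := hs y hy
    have hq : 0 < √(R ^ 2 - y ^ 2) := Real.sqrt_pos.2 hp
    have h1 : HasDerivAt (fun t : ℝ => R ^ 2 - t ^ 2) (-(2 * y)) y := by
      simpa using (hasDerivAt_pow 2 y).const_sub (R ^ 2)
    have hd : HasDerivAt (fun t => t / √(R ^ 2 - t ^ 2))
        ((1 * √(R ^ 2 - y ^ 2) - y * (-(2 * y) / (2 * √(R ^ 2 - y ^ 2)))) /
          √(R ^ 2 - y ^ 2) ^ 2) y :=
      (hasDerivAt_id y).div (h1.sqrt hp.ne') hq.ne'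
    refine hd.arctan.congr_deriv ?_
    generalize √(R ^ 2 - y ^ 2) = s at hq
    have h3 : 0 < s ^ 2 + y ^ 2 := by positivity
    field_simp
    ring
  by_contra! hle
  obtain ⟨c, hc, x₀, hx₀, hlt⟩ := exists_le_neg_of_deriv_pos_of_nonpos (b := r)
    (D := fun t => Real.arctan (deriv f t) - Real.arctan (t / √(R ^ 2 - t ^ 2)))
    (fun y hy => ((hf.differentiableAt_deriv y hy.1).hasDerivAt.arctan).sub (harc y hy))
    (fun y hy hy0 => by
      have hq : 0 < √(R ^ 2 - y ^ 2) := Real.sqrt_pos.2 (hs y hy)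
      have h1 : deriv f y ≤ y / √(R ^ 2 - y ^ 2) :=
        Real.arctan_strictMono.le_iff_le.1 (sub_nonpos.1 hy0)
      have h2 : deriv f y / y ≤ 1 / √(R ^ 2 - y ^ 2) := by
        rw [div_le_iff₀ hy.1]
        simpa [div_eq_inv_mul] using h1
      have hr0 : 0 < r := hy.1.trans hy.2
      have h3 : α / f r < α / f y := div_lt_div_of_pos_left hα (hf.pos y hy.1.le)
        (hf.strictMonoOn hα (mem_Ici.2 hy.1.le) (mem_Ici.2 hr0.le) hy.2)
      have h4 : 2 / √(R ^ 2 - y ^ 2) ≤ 2 / √(R ^ 2 - r ^ 2) := by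
        refine div_le_div_of_nonneg_left (by norm_num) (Real.sqrt_pos.2 (by nlinarith))
          (Real.sqrt_le_sqrt ?_)
        nlinarith [hy.1, hy.2]
      have h5 := hf.ode y hy.1
      have h6 : 2 / √(R ^ 2 - y ^ 2) = 2 * (1 / √(R ^ 2 - y ^ 2)) := by ring
      rw [one_div_mul_eq_div]
      linarith)
    hx (sub_nonpos.2 (Real.arctan_strictMono.monotone hle))
  have hcont : ContinuousAt (fun t => Real.arctan (t / √(R ^ 2 - t ^ 2))) 0 := by
    refine Real.continuous_arctan.continuousAt.comp (continuousAt_id.div (by fun_prop) ?_)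
    simpa [Real.sqrt_sq hR.le] using hR.ne'
  have hsmall : ∀ᶠ y in 𝓝[>] (0 : ℝ), Real.arctan (y / √(R ^ 2 - y ^ 2)) < -c :=
    (hcont.mono_left nhdsWithin_le_nhds).eventually (gt_mem_nhds (by simpa using hc))
  obtain ⟨y, hy, hyx⟩ := (hsmall.and (Ioo_mem_nhdsGT hx₀.1)).exists
  have h1 : 0 < Real.arctan (deriv f y) := Real.arctan_pos.2 (hf.deriv_pos hα hyx.1)
  have h2 := hlt y hyx
  linarith

end IsRotationalSolution

theorem theorem4p1 (α z₀ : ℝ) (hα : 0 < α) (f : ℝ → ℝ) (hf : IsRotationalSolution α z₀ f) :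
    (∀ r : ℝ, 0 < r → ∀ x : ℝ, 0 ≤ x → x < r →
      f x < ((α + 2) / α) * f r - Real.sqrt (r ^ 2 + 4 * f r ^ 2 / α ^ 2 - x ^ 2)) ∧
    (∀ x : ℝ, 0 < x → f 0 < f x) ∧
    (∀ r : ℝ, 0 < r →
      f 0 < ((α + 2) / α) * f r - Real.sqrt (r ^ 2 + 4 * f r ^ 2 / α ^ 2)) := by
  have main : ∀ r : ℝ, 0 < r → ∀ x : ℝ, 0 ≤ x → x < r →
      f x < ((α + 2) / α) * f r - √(r ^ 2 + 4 * f r ^ 2 / α ^ 2 - x ^ 2) := by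
    intro r hr x hx hxr
    have hfr : 0 < f r := hf.pos r hr.le
    obtain ⟨R, hR, hR2⟩ : ∃ R : ℝ, 0 < R ∧ R ^ 2 = r ^ 2 + 4 * f r ^ 2 / α ^ 2 :=
      ⟨√(r ^ 2 + 4 * f r ^ 2 / α ^ 2), Real.sqrt_pos.2 (by positivity),
        Real.sq_sqrt (by positivity)⟩
    have hrR : r < R := by
      have : 0 < 4 * f r ^ 2 / α ^ 2 := by positivity
      exact lt_of_pow_lt_pow_left₀ 2 hR.le (by linarith)
    have hsr : √(R ^ 2 - r ^ 2) = 2 * f r / α := by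
      rw [show R ^ 2 - r ^ 2 = (2 * f r / α) ^ 2 by rw [hR2]; ring]
      exact Real.sqrt_sq (by positivity)
    have hcurv : 2 / √(R ^ 2 - r ^ 2) = α / f r := by
      rw [hsr]
      field_simp
    -- `f` minus the arc increases, up to a constant, to its value at `r`.
    have hmono : StrictMonoOn (fun t => f t + √(R ^ 2 - t ^ 2)) (Icc 0 r) := by
      refine strictMonoOn_of_deriv_pos (convex_Icc 0 r)
        ((hf.continuousOn.mono fun z hz => hz.1).add (by fun_prop)) fun t ht => ?_
      rw [interior_Icc] at ht
      have h1 : HasDerivAt (fun t : ℝ => R ^ 2 - t ^ 2) (-(2 * t)) t := by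
        simpa using (hasDerivAt_pow 2 t).const_sub (R ^ 2)
      have hp : 0 < R ^ 2 - t ^ 2 := by nlinarith [ht.1, ht.2]
      have h2 := (hf.differentiableAt t ht.1).hasDerivAt.add (h1.sqrt hp.ne')
      have h3 := hf.arc_slope_lt_deriv hα hR hrR hcurv ht
      have h4 : -(2 * t) / (2 * √(R ^ 2 - t ^ 2)) = -(t / √(R ^ 2 - t ^ 2)) := by
        rw [← mul_neg, mul_div_mul_left _ _ two_ne_zero, neg_div]
      rw [show (fun t => f t + √(R ^ 2 - t ^ 2)) = f + fun t => √(R ^ 2 - t ^ 2) from rfl,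
        h2.deriv, h4]
      linarith
    have h := hmono ⟨hx, hxr.le⟩ ⟨hr.le, le_rfl⟩ hxr
    simp only [hsr] at h
    rw [← hR2]
    have h5 : (α + 2) / α * f r = f r + 2 * f r / α := by
      field_simp
    linarith
  refine ⟨main, fun x hx => hf.strictMonoOn hα (mem_Ici.2 le_rfl) (mem_Ici.2 hx.le) hx,
    fun r hr => ?_⟩
  simpa using main r hr 0 le_rfl hr
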